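/- Let $n\ge 0$ and let $A=[a_{ij}]$ be a strictly upper triangular $n\times n$ matrix over $\mathbb F_2$. Let $C_2^n=\langle c_1,\dots,c_n\rangle$ be the elementary abelian group of rank $n$, acting freely on the torus $T^n=(S^1)^n$, $S^1\subset\mathbb C$, by $$c_i\cdot(z_1,\dots,z_n)=(z_1,\dots,z_{i-1},-z_i,c_{i,i+1}(z_{i+1}),\dots,c_{i,n}(z_n)),$$ where $c_{i,j}(z)=z$ if $a_{ij}=0$ and $c_{i,j}(z)=\overline z$ if $a_{ij}=1$. Let $M(A)=T^n/C_2^n$ be the corresponding real Bott manifold, $\Gamma=\pi_1(M(A))$ its fundamental group (at any base point), and $\pi\colon\Gamma\to C_2^n$ the epimorphism defined by the covering $T^n\to M(A)$. For $1\le i\le n$ let $x_i=\pi^*(c_i^*)\in H^1(\Gamma,\mathbb F_2)$, where $c_i^*\in H^1(C_2^n,\mathbb F_2)=\operatorname{Hom}(C_2^n,\mathbb F_2)$ is given by $c_i^*(c_j)=\delta_{ij}$. Let $\beta^{(2)}\colon H^2(\Gamma,\mathbb F_2)\to H^3(\Gamma,\mathbb F_2)$ be the Bockstein map, that is, the connecting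 homomorphism of the short exact sequence $0\to\mathbb F_2\to\mathbb Z/4\to\mathbb F_2\to 0$ of trivial $\Gamma$-modules. Then, with products taken in the cohomology ring $H^*(\Gamma,\mathbb F_2)$ (cup product), $$\beta^{(2)}(x_ix_j)=x_i^2x_j+x_ix_j^2\qquad\text{for all }1\le i,j\le n.$$ -/

import Mathlib

noncomputable section

namespace GroupCoh

open CategoryTheory

/-- The group cohomology `Hⁿ(G, M)` of `G` with coefficients in the abelian group `M` on which `G`
acts trivially. -/
abbrev H (G : Type) [Group G] (M : Type) [AddCommGroup M] (n : ℕ) : ModuleCat ℤ :=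
  groupCohomology (Rep.trivial ℤ G M) n

section Cup

variable {G : Type} [Group G] {R : Type} [CommRing R] {p q r : ℕ}

/-- The cup product of inhomogeneous cochains with values in a commutative ring `R` with trivial
action: `(f ⌣ g)(x₁, …, x_{p+q}) = f(x₁, …, x_p) * g(x_{p+1}, …, x_{p+q})`. -/
def cupCochain (h : p + q = r) (f : (Fin p → G) → R) (g : (Fin q → G) → R) :
    (Fin r → G) → R :=
  fun x => f (fun i => x (Fin.cast h (Fin.castAdd q i))) *
    g (fun i => x (Fin.cast h (Fin.natAdd p i)))

lemma d_trivial_apply (n : ℕ) (f : (Fin n → G) → R) (x : Fin (n + 1) → G) :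
    inhomogeneousCochains.d (Rep.trivial ℤ G R) n f x =
      f (fun i => x i.succ) +
        ∑ j : Fin (n + 1), (-1 : ℤ) ^ ((j : ℕ) + 1) • f (Fin.contractNth j (· * ·) x) := by
  rfl

/-- The Leibniz rule `d(f ⌣ g) = df ⌣ g + (-1)ᵖ f ⌣ dg` for the cup product of cochains. -/
lemma d_cupCochain (f : (Fin p → G) → R) (g : (Fin q → G) → R) :
    inhomogeneousCochains.d (Rep.trivial ℤ G R) (p + q) (cupCochain rfl f g) =
      cupCochain (show p + 1 + q = p + q + 1 by omega)
          (inhomogeneousCochains.d (Rep.trivial ℤ G R) p f) g +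
        (-1 : ℤ) ^ p • cupCochain (show p + (q + 1) = p + q + 1 from rfl) f
          (inhomogeneousCochains.d (Rep.trivial ℤ G R) q g) := by
  funext x
  have h1 : ∀ j : Fin p, cupCochain (rfl : p + q = p + q) f g
        (Fin.contractNth (Fin.castAdd (q + 1) j : Fin (p + q + 1)) (· * ·) x) =
      f (Fin.contractNth j.castSucc (· * ·)
        (fun i => x (Fin.cast (show p + 1 + q = p + q + 1 by omega) (Fin.castAdd q i)))) *
      g (fun i => x (Fin.cast (show p + 1 + q = p + q + 1 by omega) (Fin.natAdd (p + 1) i))) := by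
    intro j
    unfold cupCochain
    congr 2
    · funext i
      rw [Fin.contractNth_apply_of_gt]
      · congr 1; ext; simp; omega
      · simp; omega
  have h2 : ∀ j : Fin (q + 1), cupCochain (rfl : p + q = p + q) f g
        (Fin.contractNth (Fin.natAdd p j : Fin (p + q + 1)) (· * ·) x) =
      f (fun i => x (Fin.castAdd (q + 1) i)) *
      g (Fin.contractNth j (· * ·) (fun i => x (Fin.natAdd p i))) := by
    intro j
    unfold cupCochain
    congr 2
    · funext i
      rw [Fin.contractNth_apply_of_lt]
      · rfl
      · simp; omega
    · funext i
      simp only [Fin.contractNth, Fin.val_cast, Fin.val_natAdd, add_lt_add_iff_left,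
        add_right_inj]
      rfl
  have h4 : Fin.contractNth (Fin.last p) (· * ·)
      (fun i => x (Fin.cast (show p + 1 + q = p + q + 1 by omega) (Fin.castAdd q i))) =
      fun i => x (Fin.castAdd (q + 1) i) := by
    funext i
    rw [Fin.contractNth_apply_of_lt]
    · rfl
    · simp
  have h5 : (fun i : Fin q => x (Fin.cast (show p + 1 + q = p + q + 1 by omega)
      (Fin.natAdd (p + 1) i))) = fun i => x (Fin.natAdd p i.succ) := by
    funext i
    congr 1; ext; simp; omega
  rw [d_trivial_apply]
  have hs : (∑ j : Fin (p + q + 1), (-1 : ℤ) ^ ((j : ℕ) + 1) •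
      cupCochain (rfl : p + q = p + q) f g (Fin.contractNth j (· * ·) x)) =
      (∑ j : Fin p, (-1 : ℤ) ^ ((j : ℕ) + 1) • cupCochain (rfl : p + q = p + q) f g
        (Fin.contractNth (Fin.castAdd (q + 1) j : Fin (p + q + 1)) (· * ·) x)) +
      ∑ j : Fin (q + 1), (-1 : ℤ) ^ (p + (j : ℕ) + 1) • cupCochain (rfl : p + q = p + q) f g
        (Fin.contractNth (Fin.natAdd p j : Fin (p + q + 1)) (· * ·) x) :=
    Fin.sum_univ_add (a := p) (b := q + 1) _
  rw [hs]
  simp only [h1, h2]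
  simp only [Pi.add_apply, Pi.smul_apply]
  conv_rhs => unfold cupCochain
  rw [d_trivial_apply, d_trivial_apply, Fin.sum_univ_castSucc (n := p), h4, h5]
  have h3 : cupCochain (rfl : p + q = p + q) f g (fun i => x i.succ) =
      f (fun i : Fin p => x (Fin.cast (show p + 1 + q = p + q + 1 by omega)
        (Fin.castAdd q i.succ))) * g (fun i => x (Fin.natAdd p i.succ)) := by
    rfl
  rw [h3]
  have e1 : ∀ i : Fin (q + 1), x (Fin.cast (rfl : p + (q + 1) = p + q + 1) (Fin.natAdd p i)) =
      x (Fin.natAdd p i) := fun _ => rfl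
  have e2 : ∀ i : Fin p, x (Fin.cast (rfl : p + (q + 1) = p + q + 1) (Fin.castAdd (q + 1) i)) =
      x (Fin.castAdd (q + 1) i) := fun _ => rfl
  simp only [e1, e2, Fin.val_castSucc, Fin.val_last]
  simp only [zsmul_eq_mul, mul_add, add_mul, Finset.mul_sum, Finset.sum_mul, Int.cast_pow,
    Int.cast_neg, Int.cast_one]
  have e3 : ∀ j : Fin (q + 1), (-1 : R) ^ (p + (j : ℕ) + 1) *
      (f (fun i => x (Fin.castAdd (q + 1) i)) *
        g (Fin.contractNth j (· * ·) fun i => x (Fin.natAdd p i))) =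
      (-1 : R) ^ p * (f (fun i => x (Fin.castAdd (q + 1) i)) * ((-1) ^ ((j : ℕ) + 1) *
        g (Fin.contractNth j (· * ·) fun i => x (Fin.natAdd p i)))) := by
    intro j; ring
  simp only [e3, mul_assoc]
  ring

lemma d_cupCochain_eq_zero (h : p + q = r) {f : (Fin p → G) → R} {g : (Fin q → G) → R}
    (hf : inhomogeneousCochains.d (Rep.trivial ℤ G R) p f = 0)
    (hg : inhomogeneousCochains.d (Rep.trivial ℤ G R) q g = 0) :
    inhomogeneousCochains.d (Rep.trivial ℤ G R) r (cupCochain h f g) = 0 := by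
  subst h
  rw [d_cupCochain, hf, hg]
  funext x
  change (0 : R) * _ + ((-1 : ℤ) ^ p) • (_ * (0 : R)) = 0
  simp

lemma d_iCocycles (a : groupCohomology.cocycles (Rep.trivial ℤ G R) p) :
    inhomogeneousCochains.d (Rep.trivial ℤ G R) p
      (groupCohomology.iCocycles (Rep.trivial ℤ G R) p a) = 0 := by
  rw [← groupCohomology.inhomogeneousCochains.d_def]
  exact congr($((groupCohomology.inhomogeneousCochains
    (Rep.trivial ℤ G R)).iCycles_d p (p + 1)) a)

/-- The cup product of cocycles. -/
def cupCocycle (h : p + q = r) (a : groupCohomology.cocycles (Rep.trivial ℤ G R) p)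
    (b : groupCohomology.cocycles (Rep.trivial ℤ G R) q) :
    groupCohomology.cocycles (Rep.trivial ℤ G R) r :=
  groupCohomology.cocyclesMk (A := Rep.trivial ℤ G R)
    (cupCochain h (groupCohomology.iCocycles (Rep.trivial ℤ G R) p a)
      (groupCohomology.iCocycles (Rep.trivial ℤ G R) q b))
    (d_cupCochain_eq_zero h (d_iCocycles a) (d_iCocycles b))

lemma π_surjective (x : H G R p) : ∃ a, groupCohomology.π (Rep.trivial ℤ G R) p a = x :=
  groupCohomology_induction_on x fun a => ⟨a, rfl⟩

/-- The cup product `Hᵖ(G, R) × H^q(G, R) → Hʳ(G, R)`, `p + q = r`, for a commutative ring `R` with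
trivial action: the class of the cup product of representing cocycles. By `cup_π` it does not
depend on the representatives. -/
def cup (h : p + q = r) (x : H G R p) (y : H G R q) : H G R r :=
  groupCohomology.π (Rep.trivial ℤ G R) r
    (cupCocycle h (π_surjective x).choose (π_surjective y).choose)

lemma iCocycles_injective :
    Function.Injective (groupCohomology.iCocycles (Rep.trivial ℤ G R) p) :=
  (ModuleCat.mono_iff_injective _).1 inferInstance

/-- A cocycle whose class is zero is a coboundary. -/
lemma exists_of_π_eq_zero (a : groupCohomology.cocycles (Rep.trivial ℤ G R) p)
    (ha : groupCohomology.π (Rep.trivial ℤ G R) p a = 0) (k : ℕ)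
    (hk : (ComplexShape.up ℕ).prev p = k) :
    ∃ c, (groupCohomology.inhomogeneousCochains (Rep.trivial ℤ G R)).d k p c =
      groupCohomology.iCocycles (Rep.trivial ℤ G R) p a := by
  subst hk
  let K := groupCohomology.inhomogeneousCochains (Rep.trivial ℤ G R)
  have hex : (ShortComplex.mk (K.toCycles ((ComplexShape.up ℕ).prev p) p) (K.homologyπ p)
      (by simp)).Exact :=
    ShortComplex.exact_of_g_is_cokernel _ (K.homologyIsCokernel _ p rfl)
  obtain ⟨c, hc⟩ := (ShortComplex.moduleCat_exact_iff _).1 hex a ha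
  refine ⟨c, ?_⟩
  rw [← hc]
  exact (congr($(K.toCycles_i ((ComplexShape.up ℕ).prev p) p) c)).symm

lemma π_eq_zero_of_d (a : groupCohomology.cocycles (Rep.trivial ℤ G R) p) (k : ℕ)
    (c : (groupCohomology.inhomogeneousCochains (Rep.trivial ℤ G R)).X k)
    (h : (groupCohomology.inhomogeneousCochains (Rep.trivial ℤ G R)).d k p c =
      groupCohomology.iCocycles (Rep.trivial ℤ G R) p a) :
    groupCohomology.π (Rep.trivial ℤ G R) p a = 0 := by
  let K := groupCohomology.inhomogeneousCochains (Rep.trivial ℤ G R)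
  have : a = K.toCycles k p c := by
    apply iCocycles_injective
    rw [← h]
    exact (congr($(K.toCycles_i k p) c)).symm
  rw [this]
  exact congr($(K.toCycles_comp_homologyπ k p) c)

/-- Cohomologous cocycles of degree `p` are equal or differ by the differential of a cochain of
degree `p - 1`. -/
lemma exists_d_eq (a a' : groupCohomology.cocycles (Rep.trivial ℤ G R) p)
    (h : groupCohomology.π (Rep.trivial ℤ G R) p a = groupCohomology.π (Rep.trivial ℤ G R) p a') :
    groupCohomology.iCocycles (Rep.trivial ℤ G R) p a =
        groupCohomology.iCocycles (Rep.trivial ℤ G R) p a' ∨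
      ∃ (k : ℕ) (hk : k + 1 = p) (c : (Fin k → G) → R),
        groupCohomology.iCocycles (Rep.trivial ℤ G R) p a =
          groupCohomology.iCocycles (Rep.trivial ℤ G R) p a' +
            (fun x => inhomogeneousCochains.d (Rep.trivial ℤ G R) k c
              (fun i => x (Fin.cast hk i)) : (Fin p → G) → R) := by
  have h0 : groupCohomology.π (Rep.trivial ℤ G R) p (a - a') = 0 := by
    rw [map_sub, h, sub_self]
  cases p with
  | zero =>
    left
    obtain ⟨c, hc⟩ := exists_of_π_eq_zero (a - a') h0 0 (by simp)
    rw [map_sub] at hc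
    rw [HomologicalComplex.shape _ _ _ (by simp)] at hc
    exact sub_eq_zero.1 hc.symm
  | succ k =>
    right
    obtain ⟨c, hc⟩ := exists_of_π_eq_zero (a - a') h0 k (CochainComplex.prev_nat_succ k)
    rw [map_sub, groupCohomology.inhomogeneousCochains.d_def] at hc
    exact ⟨k, rfl, c, (eq_add_of_sub_eq' hc.symm)⟩

lemma π_eq_of_d (a a' : groupCohomology.cocycles (Rep.trivial ℤ G R) p) (k : ℕ) (hk : k + 1 = p)
    (c : (Fin k → G) → R)
    (h : groupCohomology.iCocycles (Rep.trivial ℤ G R) p a =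
          groupCohomology.iCocycles (Rep.trivial ℤ G R) p a' +
            (fun x => inhomogeneousCochains.d (Rep.trivial ℤ G R) k c
              (fun i => x (Fin.cast hk i)) : (Fin p → G) → R)) :
    groupCohomology.π (Rep.trivial ℤ G R) p a = groupCohomology.π (Rep.trivial ℤ G R) p a' := by
  subst hk
  rw [← sub_eq_zero, ← map_sub]
  apply π_eq_zero_of_d _ k c
  rw [map_sub, h, add_sub_cancel_left, groupCohomology.inhomogeneousCochains.d_def]
  rfl

lemma iCocycles_cupCocycle (h : p + q = r) (a : groupCohomology.cocycles (Rep.trivial ℤ G R) p)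
    (b : groupCohomology.cocycles (Rep.trivial ℤ G R) q) :
    groupCohomology.iCocycles (Rep.trivial ℤ G R) r (cupCocycle h a b) =
      cupCochain h (groupCohomology.iCocycles (Rep.trivial ℤ G R) p a)
        (groupCohomology.iCocycles (Rep.trivial ℤ G R) q b) :=
  groupCohomology.iCocycles_mk (A := Rep.trivial ℤ G R) _
    (d_cupCochain_eq_zero h (d_iCocycles a) (d_iCocycles b))

lemma π_cupCocycle_left (h : p + q = r) (a a' : groupCohomology.cocycles (Rep.trivial ℤ G R) p)
    (b : groupCohomology.cocycles (Rep.trivial ℤ G R) q)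
    (haa : groupCohomology.π (Rep.trivial ℤ G R) p a =
      groupCohomology.π (Rep.trivial ℤ G R) p a') :
    groupCohomology.π (Rep.trivial ℤ G R) r (cupCocycle h a b) =
      groupCohomology.π (Rep.trivial ℤ G R) r (cupCocycle h a' b) := by
  rcases exists_d_eq a a' haa with he | ⟨k, rfl, c, hc⟩
  · congr 1
    apply iCocycles_injective
    rw [iCocycles_cupCocycle, iCocycles_cupCocycle, he]
  · refine π_eq_of_d _ _ (k + q) (by omega)
      (cupCochain rfl c (groupCohomology.iCocycles (Rep.trivial ℤ G R) q b)) ?_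
    rw [iCocycles_cupCocycle, iCocycles_cupCocycle, hc, d_cupCochain, d_iCocycles]
    subst h
    funext x
    change (_ + _) * _ = _ * _ + (_ * _ + ((-1 : ℤ) ^ k) • (_ * (0 : R)))
    rw [mul_zero, smul_zero, add_zero, add_mul]
    rfl

lemma π_cupCocycle_right (h : p + q = r) (a : groupCohomology.cocycles (Rep.trivial ℤ G R) p)
    (b b' : groupCohomology.cocycles (Rep.trivial ℤ G R) q)
    (hbb : groupCohomology.π (Rep.trivial ℤ G R) q b =
      groupCohomology.π (Rep.trivial ℤ G R) q b') :
    groupCohomology.π (Rep.trivial ℤ G R) r (cupCocycle h a b) =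
      groupCohomology.π (Rep.trivial ℤ G R) r (cupCocycle h a b') := by
  rcases exists_d_eq b b' hbb with he | ⟨k, rfl, c, hc⟩
  · congr 1
    apply iCocycles_injective
    rw [iCocycles_cupCocycle, iCocycles_cupCocycle, he]
  · refine π_eq_of_d _ _ (p + k) (by omega)
      ((-1 : ℤ) ^ p • cupCochain rfl (groupCohomology.iCocycles (Rep.trivial ℤ G R) p a) c) ?_
    rw [iCocycles_cupCocycle, iCocycles_cupCocycle, hc, map_smul, d_cupCochain, d_iCocycles]
    subst h
    funext x
    change _ * (_ + _) = _ * _ + ((-1 : ℤ) ^ p) • ((0 : R) * _ + ((-1 : ℤ) ^ p) • (_ * _))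
    rw [zero_mul, zero_add, smul_smul, ← mul_pow, neg_mul_neg, one_mul, one_pow, one_smul, mul_add]
    rfl

/-- The cup product of cohomology classes may be computed on any representing cocycles. -/
theorem cup_π (h : p + q = r) (a : groupCohomology.cocycles (Rep.trivial ℤ G R) p)
    (b : groupCohomology.cocycles (Rep.trivial ℤ G R) q) :
    cup h (groupCohomology.π (Rep.trivial ℤ G R) p a) (groupCohomology.π (Rep.trivial ℤ G R) q b) =
      groupCohomology.π (Rep.trivial ℤ G R) r (cupCocycle h a b) :=
  (π_cupCocycle_left h _ _ _ (π_surjective _).choose_spec).trans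
    (π_cupCocycle_right h _ _ _ (π_surjective _).choose_spec)

end Cup

section Bockstein

variable (G : Type) [Group G]

/-- The injection `𝔽₂ → ℤ/4`, `0 ↦ 0`, `1 ↦ 2`. -/
def twoMul : ZMod 2 →+ ZMod 4 where
  toFun a := 2 * (a.val : ZMod 4)
  map_zero' := by decide
  map_add' := by decide

/-- Reduction modulo `2`, `ℤ/4 → 𝔽₂`. -/
def modTwo : ZMod 4 →+ ZMod 2 :=
  (ZMod.castHom (show 2 ∣ 4 by norm_num) (ZMod 2)).toAddMonoidHom

/-- A homomorphism of abelian groups as a homomorphism of `G`-modules with trivial action. -/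
def trivialHom {M N : Type} [AddCommGroup M] [AddCommGroup N] (f : M →+ N) :
    Rep.trivial ℤ G M ⟶ Rep.trivial ℤ G N :=
  Rep.ofHom ⟨f.toIntLinearMap, fun _ => rfl⟩

/-- The sequence `0 → 𝔽₂ → ℤ/4 → 𝔽₂ → 0` of trivial `G`-modules. -/
def bocksteinSequence : ShortComplex (Rep ℤ G) :=
  ShortComplex.mk (trivialHom G twoMul) (trivialHom G modTwo) (by
    ext (a : ZMod 2)
    change modTwo (twoMul a) = 0
    revert a
    decide)

lemma exact_of_forall {k K : Type} [CommRing k] [Group K] (S : ShortComplex (Rep.{0} k K))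
    (h : ∀ a : S.X₂, S.g.hom a = 0 → ∃ b : S.X₁, S.f.hom b = a) : S.Exact := by
  rw [← ShortComplex.exact_map_iff_of_faithful _ (forget₂ (Rep.{0} k K) (ModuleCat.{0} k)),
    ShortComplex.moduleCat_exact_iff]
  exact h

theorem bocksteinSequence_shortExact : (bocksteinSequence G).ShortExact where
  exact := by
    apply exact_of_forall
    intro (a : ZMod 4) (ha : modTwo a = 0)
    change ∃ b : ZMod 2, twoMul b = a
    revert a
    decide
  mono_f := by
    rw [Rep.mono_iff_injective]
    change Function.Injective twoMul
    decide
  epi_g := by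
    rw [Rep.epi_iff_surjective]
    change Function.Surjective modTwo
    decide

/-- The Bockstein map `β⁽ⁿ⁾ : Hⁿ(G, 𝔽₂) → Hⁿ⁺¹(G, 𝔽₂)`, the connecting homomorphism of the long
exact cohomology sequence of `0 → 𝔽₂ → ℤ/4 → 𝔽₂ → 0`. -/
def bockstein (n : ℕ) : H G (ZMod 2) n ⟶ H G (ZMod 2) (n + 1) :=
  groupCohomology.δ (bocksteinSequence_shortExact G) n (n + 1) rfl

variable {G}

/-- The class in `H¹(G, M)` of a homomorphism `G → M`. -/
def classOfHom {M : Type} [AddCommGroup M] (f : Additive G →+ M) : H G M 1 :=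
  (groupCohomology.H1IsoOfIsTrivial (Rep.trivial ℤ G M)).inv f

/-- The map `π^* : Hⁿ(K, M) → Hⁿ(G, M)` induced by a group homomorphism `π : G → K`. -/
def pullback {K : Type} [Group K] (π : G →* K) (M : Type) [AddCommGroup M] (n : ℕ) :
    H K M n ⟶ H G M n :=
  groupCohomology.map (A := Rep.trivial ℤ K M) (B := Rep.trivial ℤ G M) π
    (Rep.ofHom ⟨LinearMap.id, fun _ => rfl⟩) n

end Bockstein

end GroupCoh

namespace RealBott

variable {n : ℕ}

/-- The elementary abelian group `C₂ⁿ`. -/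
abbrev C2Pow (n : ℕ) : Type := Fin n → Multiplicative (ZMod 2)

/-- The standard generators `c₁, …, cₙ` of `C₂ⁿ`. -/
def gen (i : Fin n) : C2Pow n := Pi.mulSingle i (Multiplicative.ofAdd 1)

/-- The homomorphism `cᵢ^* : C₂ⁿ → 𝔽₂` with `cᵢ^*(cⱼ) = δᵢⱼ`. -/
def cDual (i : Fin n) : Additive (C2Pow n) →+ ZMod 2 :=
  MonoidHom.toAdditiveLeft (Pi.evalMonoidHom (fun _ : Fin n => Multiplicative (ZMod 2)) i)

/-- `A` is a strictly upper triangular matrix over `𝔽₂`. -/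
def IsBottMatrix (A : Matrix (Fin n) (Fin n) (ZMod 2)) : Prop :=
  ∀ i j, j ≤ i → A i j = 0

/-- The torus `Tⁿ = (S¹)ⁿ`, as a space with the action of `C₂ⁿ` determined by `A`. -/
def Torus (_A : Matrix (Fin n) (Fin n) (ZMod 2)) : Type := Fin n → Circle

instance (A : Matrix (Fin n) (Fin n) (ZMod 2)) : TopologicalSpace (Torus A) :=
  inferInstanceAs (TopologicalSpace (Fin n → Circle))

instance (A : Matrix (Fin n) (Fin n) (ZMod 2)) : T2Space (Torus A) :=
  inferInstanceAs (T2Space (Fin n → Circle))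

instance (A : Matrix (Fin n) (Fin n) (ZMod 2)) : CompactSpace (Torus A) :=
  inferInstanceAs (CompactSpace (Fin n → Circle))

/-- `negPow ε z = (-1)^ε z`. -/
def negPow (ε : ZMod 2) (z : Circle) : Circle := if ε = 0 then z else -z

/-- `conjPow a z` is `z` if `a = 0` and the complex conjugate of `z`, i.e. `z⁻¹`, if `a = 1`. -/
def conjPow (a : ZMod 2) (z : Circle) : Circle := if a = 0 then z else z⁻¹

lemma conjPow_one (z : Circle) : ((conjPow 1 z : Circle) : ℂ) = (starRingEnd ℂ) z := by
  rw [conjPow, if_neg one_ne_zero, Circle.coe_inv_eq_conj]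

lemma negPow_conjPow_add (a b a' b' : ZMod 2) (z : Circle) :
    negPow (a + b) (conjPow (a' + b') z) = negPow a (conjPow a' (negPow b (conjPow b' z))) := by
  have h : ∀ x : ZMod 2, x = 0 ∨ x = 1 := by decide
  have h11 : (1 + 1 : ZMod 2) = 0 := by decide
  rcases h a with rfl | rfl <;> rcases h b with rfl | rfl <;> rcases h a' with rfl | rfl <;>
    rcases h b' with rfl | rfl <;> simp [negPow, conjPow, h11]

/-- The action of `C₂ⁿ` on `Tⁿ`: the element `∏ cᵢ^{εᵢ}` sends `(z₁, …, zₙ)` to the point with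
`j`-th coordinate `(-1)^{εⱼ} z_j` or `(-1)^{εⱼ} \bar{z_j}`, according as `∑ᵢ εᵢ aᵢⱼ` is `0` or `1`.
See `gen_smul_apply` for the action of the generators. -/
instance (A : Matrix (Fin n) (Fin n) (ZMod 2)) : MulAction (C2Pow n) (Torus A) where
  smul g z := fun j =>
    negPow (g j).toAdd (conjPow (∑ i, (g i).toAdd * A i j) (z j))
  one_smul z := by
    funext j
    change negPow 0 (conjPow (∑ i, 0 * A i j) (z j)) = z j
    simp [negPow, conjPow]
  mul_smul g h z := by
    funext j
    change negPow ((g j).toAdd + (h j).toAdd)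
        (conjPow (∑ i, ((g i).toAdd + (h i).toAdd) * A i j) (z j)) =
      negPow (g j).toAdd (conjPow (∑ i, (g i).toAdd * A i j)
        (negPow (h j).toAdd (conjPow (∑ i, (h i).toAdd * A i j) (z j))))
    simp only [add_mul, Finset.sum_add_distrib]
    exact negPow_conjPow_add _ _ _ _ _

lemma smul_apply (A : Matrix (Fin n) (Fin n) (ZMod 2)) (g : C2Pow n) (z : Torus A) (j : Fin n) :
    (g • z) j = negPow (g j).toAdd (conjPow (∑ i, (g i).toAdd * A i j) (z j)) :=
  rfl

/-- The generator `cᵢ` acts by `z_j ↦ z_j` for `j < i`, `z_i ↦ -z_i`, and, for `j > i`,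
`z_j ↦ z_j` if `aᵢⱼ = 0` and `z_j ↦ \bar{z_j}` if `aᵢⱼ = 1`. -/
theorem gen_smul_apply {A : Matrix (Fin n) (Fin n) (ZMod 2)} (hA : IsBottMatrix A) (i j : Fin n)
    (z : Torus A) :
    (gen i • z) j = if j < i then z j else if j = i then -z i else conjPow (A i j) (z j) := by
  have hc : ∀ k, (gen i k).toAdd = if k = i then (1 : ZMod 2) else 0 := by
    intro k
    by_cases hk : k = i
    · subst hk; simp [gen]
    · simp [gen, hk]
  rw [smul_apply]
  simp only [hc, ite_mul, one_mul, zero_mul, Finset.sum_ite_eq', Finset.mem_univ, if_true]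
  rcases lt_trichotomy j i with h | rfl | h
  · simp [h, h.ne, hA i j h.le, negPow, conjPow]
  · simp [hA j j le_rfl, negPow, conjPow]
  · simp [h.not_gt, h.ne', negPow]

theorem eq_one_of_smul_eq {A : Matrix (Fin n) (Fin n) (ZMod 2)} (hA : IsBottMatrix A)
    (g : C2Pow n) (z : Torus A) (h : g • z = z) : g = 1 := by
  have key : ∀ m : ℕ, ∀ j : Fin n, (j : ℕ) = m → (g j).toAdd = 0 := by
    intro m
    induction m using Nat.strong_induction_on with
    | _ m ih =>
      rintro j rfl
      have hs : ∑ i, (g i).toAdd * A i j = 0 := by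
        refine Finset.sum_eq_zero fun i _ => ?_
        by_cases hij : j ≤ i
        · rw [hA i j hij, mul_zero]
        · rw [ih i (by simpa using hij) i rfl, zero_mul]
      have hj := congrFun h j
      rw [smul_apply, hs] at hj
      by_contra hne
      simp only [negPow, conjPow, if_true, if_neg hne] at hj
      have h2 : -((z j : Circle) : ℂ) = z j := congrArg (fun w : Circle => (w : ℂ)) hj
      exact Circle.coe_ne_zero (z j) (self_eq_neg.1 h2.symm)
  funext j
  exact Multiplicative.toAdd.injective (key j j rfl)

instance (A : Matrix (Fin n) (Fin n) (ZMod 2)) : ContinuousConstSMul (C2Pow n) (Torus A) where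
  continuous_const_smul g := by
    refine continuous_pi fun j => ?_
    have hj : Continuous fun z : Torus A => z j := continuous_apply (A := fun _ : Fin n => Circle) j
    change Continuous fun z : Torus A =>
      negPow (g j).toAdd (conjPow (∑ i, (g i).toAdd * A i j) (z j))
    unfold negPow conjPow
    split_ifs
    · exact hj
    · exact hj.inv
    · exact hj.neg
    · exact hj.inv.neg

/-- The real Bott manifold `M(A) = Tⁿ / C₂ⁿ`. -/
abbrev Manifold (A : Matrix (Fin n) (Fin n) (ZMod 2)) : Type :=
  Quotient (MulAction.orbitRel (C2Pow n) (Torus A))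

/-- The quotient map `Tⁿ → M(A)`. -/
def proj (A : Matrix (Fin n) (Fin n) (ZMod 2)) : Torus A → Manifold A :=
  Quotient.mk (MulAction.orbitRel (C2Pow n) (Torus A))

theorem isQuotientCoveringMap_proj {A : Matrix (Fin n) (Fin n) (ZMod 2)} (hA : IsBottMatrix A) :
    IsQuotientCoveringMap (proj A) (C2Pow n) := by
  have : IsCancelSMul (C2Pow n) (Torus A) :=
    isCancelSMul_iff_eq_one_of_smul_eq.mpr fun g z h => eq_one_of_smul_eq hA g z h
  have : ProperlyDiscontinuousSMul (C2Pow n) (Torus A) := ⟨fun _ _ => Set.toFinite _⟩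
  exact isQuotientCoveringMap_quotientMk_of_properlyDiscontinuousSMul

/-- The fundamental group `Γ = π₁(M(A))`, at the image of the point `e` of the torus. -/
abbrev Gamma (A : Matrix (Fin n) (Fin n) (ZMod 2)) (e : Torus A) : Type :=
  FundamentalGroup (Manifold A) (proj A e)

/-- The epimorphism `π : Γ → C₂ⁿ` of the Galois covering `Tⁿ → M(A)`: the lift, with origin `e`, of
a loop in the class `γ` ends in `π(γ) • e`. -/
def piHom {A : Matrix (Fin n) (Fin n) (ZMod 2)} (hA : IsBottMatrix A) (e : Torus A) :
    Gamma A e →* C2Pow n where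
  toFun γ := ((isQuotientCoveringMap_proj hA).fundamentalGroupToMulOpposite ⟨e, rfl⟩ γ).unop
  map_one' := by rw [map_one, MulOpposite.unop_one]
  map_mul' γ γ' := by rw [map_mul, MulOpposite.unop_mul, mul_comm]

/-- The class `xᵢ = π^*(cᵢ^*) ∈ H¹(Γ, 𝔽₂)`. -/
def xClass {A : Matrix (Fin n) (Fin n) (ZMod 2)} (hA : IsBottMatrix A) (e : Torus A) (i : Fin n) :
    GroupCoh.H (Gamma A e) (ZMod 2) 1 :=
  GroupCoh.pullback (piHom hA e) (ZMod 2) 1 (GroupCoh.classOfHom (cDual i))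

theorem piHom_smul {A : Matrix (Fin n) (Fin n) (ZMod 2)} (hA : IsBottMatrix A) (e : Torus A)
    (γ : Gamma A e) :
    piHom hA e γ • e = (isQuotientCoveringMap_proj hA).isCoveringMap.monodromy γ ⟨e, rfl⟩ :=
  (isQuotientCoveringMap_proj hA).unop_fundamentalGroupToMulOpposite_smul (e := ⟨e, rfl⟩)

theorem piHom_surjective {A : Matrix (Fin n) (Fin n) (ZMod 2)} (hA : IsBottMatrix A)
    (e : Torus A) : Function.Surjective (piHom hA e) := by
  have : PathConnectedSpace (Torus A) := inferInstanceAs (PathConnectedSpace (Fin n → Circle))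
  intro g
  obtain ⟨γ, hγ⟩ := (isQuotientCoveringMap_proj hA).fundamentalGroupToMulOpposite_surjective
    ⟨e, rfl⟩ (MulOpposite.op g)
  exact ⟨γ, congrArg MulOpposite.unop hγ⟩

end RealBott

end

/-!
The identity holds for the classes of any two homomorphisms `f, g : G → 𝔽₂` of any group `G`; the
theorem is the case of the homomorphisms `cᵢ^* ∘ π` and `cⱼ^* ∘ π` on `Γ`, whose classes are `xᵢ`
and `xⱼ` by naturality of `H¹(-, 𝔽₂) = Hom(-, 𝔽₂)` (`GroupCoh.pullback_classOfHom`).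

The Bockstein of the class of a cocycle is found by lifting the cocycle to a `ℤ/4`-valued cochain
and dividing the differential of the lift by `2` (`GroupCoh.bockstein_π`). Let `f̃, g̃` be the lifts of
`f, g` with values in `{0, 1} ⊆ ℤ/4`. Since `f̃(xy) = f̃(x) + f̃(y) - 2 f(x) f(y)`, the differential of
`f̃` is `2 (f ⌣ f)`, and similarly for `g̃`, so that
`d(f̃ ⌣ g̃) = df̃ ⌣ g̃ - f̃ ⌣ dg̃ = 2 (f ⌣ f ⌣ g + f ⌣ g ⌣ g)`.
This is an identity of cochains; evaluated at a triple of group elements it becomes an identity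
between finitely many residues (`GroupCoh.twoMul_eq_d_liftFour_mul`).
-/

namespace GroupCoh

variable {G : Type} [Group G]

/-- A homomorphism `f : G → M`, regarded as an inhomogeneous `1`-cocycle. -/
noncomputable def homCocycle {M : Type} [AddCommGroup M] (f : Additive G →+ M) :
    groupCohomology.cocycles (Rep.trivial ℤ G M) 1 :=
  (groupCohomology.isoCocycles₁ (Rep.trivial ℤ G M)).inv
    ((groupCohomology.cocycles₁IsoOfIsTrivial (Rep.trivial ℤ G M)).inv f)

lemma classOfHom_eq_π {M : Type} [AddCommGroup M] (f : Additive G →+ M) :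
    classOfHom f = groupCohomology.π (Rep.trivial ℤ G M) 1 (homCocycle f) :=
  rfl

lemma iCocycles_homCocycle {M : Type} [AddCommGroup M] (f : Additive G →+ M) :
    groupCohomology.iCocycles (Rep.trivial ℤ G M) 1 (homCocycle f) =
      fun x : Fin 1 → G => f (Additive.ofMul (x 0)) :=
  groupCohomology.isoCocycles₁_inv_comp_iCocycles_apply (Rep.trivial ℤ G M) _

lemma pullback_classOfHom {K M : Type} [Group K] [AddCommGroup M] (φ : G →* K)
    (f : Additive K →+ M) :
    pullback φ M 1 (classOfHom f) = classOfHom (f.comp φ.toAdditive) := by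
  change groupCohomology.map _ _ 1 (groupCohomology.H1π _ _) = groupCohomology.H1π _ _
  rw [groupCohomology.H1π_comp_map_apply]
  rfl

/-- The set-theoretic section `𝔽₂ → ℤ/4` of reduction modulo `2` with values `0` and `1`. -/
def liftFour (a : ZMod 2) : ZMod 4 := (a.val : ZMod 4)

lemma modTwo_liftFour_mul (a b : ZMod 2) : modTwo (liftFour a * liftFour b) = a * b := by
  revert a b; decide

/-- For homomorphisms `f` and `g` to `𝔽₂`, with values `a, b` of `f` at `x, y` and `b', c'` of `g` at
`y, z`, the right-hand side is the value at `(x, y, z)` of the differential of the lift of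
`f ⌣ g` to `ℤ/4`. It comes from `liftFour (a + b) = liftFour a + liftFour b - 2 a b`. -/
lemma twoMul_eq_d_liftFour_mul (a b b' c' : ZMod 2) :
    twoMul (a * b * c' + a * (b' * c')) =
      liftFour b * liftFour c' + (-(liftFour (a + b) * liftFour c') +
        liftFour a * liftFour (b' + c') + -(liftFour a * liftFour b')) := by
  revert a b b' c'; decide

/-- The Bockstein of a class is computed by lifting a representing cocycle to a `ℤ/4`-valued
cochain and dividing its differential by `2`. -/
lemma bockstein_π {p : ℕ} (z : groupCohomology.cocycles (Rep.trivial ℤ G (ZMod 2)) p)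
    (w : groupCohomology.cocycles (Rep.trivial ℤ G (ZMod 2)) (p + 1))
    (y : (Fin p → G) → ZMod 4)
    (hy : ∀ x, modTwo (y x) = groupCohomology.iCocycles (Rep.trivial ℤ G (ZMod 2)) p z x)
    (hw : ∀ x, twoMul (groupCohomology.iCocycles (Rep.trivial ℤ G (ZMod 2)) (p + 1) w x) =
      inhomogeneousCochains.d (Rep.trivial ℤ G (ZMod 4)) p y x) :
    bockstein G p (groupCohomology.π (Rep.trivial ℤ G (ZMod 2)) p z) =
      groupCohomology.π (Rep.trivial ℤ G (ZMod 2)) (p + 1) w := by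
  have h := groupCohomology.δ_apply (bocksteinSequence_shortExact G) (i := p) rfl
    (groupCohomology.iCocycles (Rep.trivial ℤ G (ZMod 2)) p z)
    (by
      rw [groupCohomology.inhomogeneousCochains.d_def]
      exact d_iCocycles z) y (funext hy)
    (groupCohomology.iCocycles (Rep.trivial ℤ G (ZMod 2)) (p + 1) w)
    (by
      rw [groupCohomology.inhomogeneousCochains.d_def]
      exact funext hw)
  have hmk {q : ℕ} (c : groupCohomology.cocycles (Rep.trivial ℤ G (ZMod 2)) q) :
      groupCohomology.cocyclesMk (A := Rep.trivial ℤ G (ZMod 2))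
        (groupCohomology.iCocycles (Rep.trivial ℤ G (ZMod 2)) q c) (d_iCocycles c) = c :=
    iCocycles_injective
      (groupCohomology.iCocycles_mk (A := Rep.trivial ℤ G (ZMod 2)) _ (d_iCocycles c))
  rw [← hmk z, ← hmk w]
  exact h

theorem bockstein_cup_classOfHom (f g : Additive G →+ ZMod 2) :
    bockstein G 2 (cup (rfl : 1 + 1 = 2) (classOfHom f) (classOfHom g)) =
      cup (rfl : 2 + 1 = 3) (cup (rfl : 1 + 1 = 2) (classOfHom f) (classOfHom f))
          (classOfHom g) +
        cup (rfl : 1 + 2 = 3) (classOfHom f)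
          (cup (rfl : 1 + 1 = 2) (classOfHom g) (classOfHom g)) := by
  simp only [classOfHom_eq_π, cup_π]
  rw [← map_add]
  apply bockstein_π _ _ (fun x => liftFour (f (.ofMul (x 0))) * liftFour (g (.ofMul (x 1))))
  · intro x
    rw [iCocycles_cupCocycle, iCocycles_homCocycle, iCocycles_homCocycle]
    exact modTwo_liftFour_mul _ _
  · have hl : groupCohomology.iCocycles (Rep.trivial ℤ G (ZMod 2)) 3 (cupCocycle rfl
          (cupCocycle (rfl : 1 + 1 = 2) (homCocycle f) (homCocycle f)) (homCocycle g)) =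
        fun x : Fin 3 → G => f (.ofMul (x 0)) * f (.ofMul (x 1)) * g (.ofMul (x 2)) := by
      rw [iCocycles_cupCocycle, iCocycles_cupCocycle, iCocycles_homCocycle, iCocycles_homCocycle]
      rfl
    have hr : groupCohomology.iCocycles (Rep.trivial ℤ G (ZMod 2)) 3 (cupCocycle rfl
          (homCocycle f) (cupCocycle (rfl : 1 + 1 = 2) (homCocycle g) (homCocycle g))) =
        fun x : Fin 3 → G => f (.ofMul (x 0)) * (g (.ofMul (x 1)) * g (.ofMul (x 2))) := by
      rw [iCocycles_cupCocycle, iCocycles_cupCocycle, iCocycles_homCocycle, iCocycles_homCocycle]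
      rfl
    intro x
    rw [d_trivial_apply, map_add, Fin.sum_univ_three]
    have h1 (a b : G) : f (.ofMul (a * b)) = f (.ofMul a) + f (.ofMul b) := map_add f _ _
    have h2 (a b : G) : g (.ofMul (a * b)) = g (.ofMul a) + g (.ofMul b) := map_add g _ _
    have key := twoMul_eq_d_liftFour_mul (f (.ofMul (x 0))) (f (.ofMul (x 1)))
      (g (.ofMul (x 1))) (g (.ofMul (x 2)))
    rw [← h1, ← h2] at key
    refine Eq.trans (congrArg twoMul ?_) (key.trans ?_)
    · exact congrArg₂ (fun a b : ZMod 2 => a + b) (congrFun hl x) (congrFun hr x)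
    · simp [Fin.contractNth]

end GroupCoh

theorem lemma3p6 {n : ℕ} (A : Matrix (Fin n) (Fin n) (ZMod 2)) (hA : RealBott.IsBottMatrix A)
    (e : RealBott.Torus A) (i j : Fin n) :
    GroupCoh.bockstein (RealBott.Gamma A e) 2
        (GroupCoh.cup (rfl : 1 + 1 = 2) (RealBott.xClass hA e i) (RealBott.xClass hA e j)) =
      GroupCoh.cup (rfl : 2 + 1 = 3)
          (GroupCoh.cup (rfl : 1 + 1 = 2) (RealBott.xClass hA e i) (RealBott.xClass hA e i))
          (RealBott.xClass hA e j) +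
        GroupCoh.cup (rfl : 1 + 2 = 3) (RealBott.xClass hA e i)
          (GroupCoh.cup (rfl : 1 + 1 = 2) (RealBott.xClass hA e j) (RealBott.xClass hA e j)) := by
  simp only [RealBott.xClass, GroupCoh.pullback_classOfHom]
  exact GroupCoh.bockstein_cup_classOfHom _ _
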